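/- There is an absolute constant $\epsilon_0>0$ with the following property. Let $q\in(1,\infty)$ and $0<r^-<r^+$. Then there is a constant $c_4>0$, depending only on $r^-$, $r^+$ and $q$, such that for every $r_0\ge r^+$, every real potential $p\in C^\infty(r_0\mathbb{D})$ with $\|p\|_{L^\infty(r_0\mathbb{D})}<\epsilon_0$, and every classical ($C^2$) solution $F:r_0\mathbb{D}\to\mathbb{R}$ of $$\Delta F+pF=0\quad\text{on } r_0\mathbb{D},$$ one has $$\|F\|_{L^\infty(r^-\mathbb{D})}\le c_4\,\|F\|_{L^q(r^+\mathbb{D})}.$$ Here $r\mathbb{D}=\{z\in\mathbb{C}:|z|<r\}$, the norms are taken with respect to the area measure, and the right-hand side is understood as $+\infty$ if $F\notin L^q(r^+\mathbb{D})$ (which can only happen when $r^+=r_0$). -/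

import Mathlib

open MeasureTheory Metric
open scoped ENNReal ContDiff

/-- `F` is a (classical) solution of `ΔF + pF = 0` on the open set `U` of the plane `ℂ = ℝ²`:
it is of class `C²` on `U` and satisfies the equation at every point of `U`. -/
def IsSchrodingerSolutionOn (F p : ℂ → ℝ) (U : Set ℂ) : Prop :=
  ContDiffOn ℝ 2 F U ∧ ∀ z ∈ U, Laplacian.laplacian F z + p z * F z = 0

/-- The `L^q` norm (as an extended nonnegative real number) of `f` on the open disk `r𝔻` of radius
`r` centred at the origin, with respect to the area measure; `q = ∞` is the essential supremum. -/
noncomputable def diskLpNorm (q : ℝ≥0∞) (r : ℝ) (f : ℂ → ℝ) : ℝ≥0∞ :=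
  eLpNorm f q (volume.restrict (ball (0 : ℂ) r))

/-! The potential enters only through the bound `|ΔF| ≤ |F|`, so the argument perturbs the mean
value property. By the divergence theorem in polar form, the radial derivative of the circular mean
at radius `ρ` is `1/ρ` times the integral of `ΔF` over the disk, hence at most `1/ρ` times the `L¹`
norm of `F` there. Hölder bounds that norm by a constant times `‖F‖_q ρ^α` with `α = 2(1 - 1/q)`.
Since `q > 1`, the resulting `ρ^(α-1)` is integrable at `0`, so `F z` differs from its circular
means by a controlled amount; averaging over radii gives the pointwise bound.

The lemmas that carry this are `hasDerivAt_mul_circle_integral_fderiv` (divergence theorem),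
`abs_le_of_abs_laplacian_le` (perturbed mean value) and `integral_abs_ball_le_eLpNorm` (Hölder). -/

/-! ### Circular means and the Laplacian in polar form -/

theorem hasDerivAt_intervalIntegral_of_continuous {u u' : ℝ → ℝ → ℝ} {a b : ℝ}
    (hu : Continuous (Function.uncurry u)) (hu' : Continuous (Function.uncurry u'))
    (h : ∀ x t, HasDerivAt (fun y => u y t) (u' x t) x) (x : ℝ) :
    HasDerivAt (fun y => ∫ t in a..b, u y t) (∫ t in a..b, u' x t) x := by
  have hc : ∀ y, Continuous (u y) := fun y => hu.comp (by fun_prop : Continuous fun t => (y, t))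
  have hc' : ∀ y, Continuous (u' y) := fun y => hu'.comp (by fun_prop : Continuous fun t => (y, t))
  obtain ⟨C, hC⟩ := ((isCompact_closedBall x 1).prod (isCompact_uIcc (a := a) (b := b))).exists_bound_of_continuousOn
    hu'.continuousOn
  refine (intervalIntegral.hasDerivAt_integral_of_dominated_loc_of_deriv_le (μ := volume)
    (bound := fun _ => C) (closedBall_mem_nhds x one_pos)
    (.of_forall fun y => (hc y).aestronglyMeasurable) ((hc x).intervalIntegrable _ _)
    (hc' x).aestronglyMeasurable (.of_forall fun t ht y hy => ?_) (by simp)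
    (.of_forall fun t _ y _ => h y t)).2
  exact hC (y, t) ⟨hy, Set.uIoc_subset_uIcc ht⟩

theorem hasDerivAt_exp_mul_I (θ : ℝ) :
    HasDerivAt (fun t : ℝ => Complex.exp (t * Complex.I))
      (Complex.I * Complex.exp (θ * Complex.I)) θ := by
  have := ((Complex.ofRealCLM.hasDerivAt (x := θ)).mul_const Complex.I).cexp
  simpa [mul_comm] using this

/-- The trace of the Hessian is the same in every orthonormal frame; here the frame is radial and
tangential. The mixed terms cancel without using symmetry of the Hessian. -/
theorem laplacian_eq_sum_of_unit (f : ℂ → ℝ) (w : ℂ) (θ : ℝ) :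
    Laplacian.laplacian f w =
      fderiv ℝ (fderiv ℝ f) w (Complex.exp (θ * Complex.I)) (Complex.exp (θ * Complex.I)) +
      fderiv ℝ (fderiv ℝ f) w (Complex.I * Complex.exp (θ * Complex.I))
        (Complex.I * Complex.exp (θ * Complex.I)) := by
  have h1 : Complex.exp (θ * Complex.I) = Real.cos θ • (1 : ℂ) + Real.sin θ • Complex.I := by
    rw [Complex.exp_mul_I]; simp
  have h2 : Complex.I * Complex.exp (θ * Complex.I) =
      Real.cos θ • Complex.I + (-Real.sin θ) • (1 : ℂ) := by
    rw [h1]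
    apply Complex.ext <;> simp
  rw [h1] at h2 ⊢
  rw [h2, InnerProductSpace.laplacian_eq_iteratedFDeriv_complexPlane]
  simp only [iteratedFDeriv_two_apply, map_add, map_smul, add_apply, smul_apply, smul_eq_mul,
    Matrix.cons_val_zero, Matrix.cons_val_one]
  linear_combination (-fderiv ℝ (fderiv ℝ f) w 1 1 -
    fderiv ℝ (fderiv ℝ f) w Complex.I Complex.I) * Real.sin_sq_add_cos_sq θ

theorem continuous_fderiv_fderiv {f : ℂ → ℝ} (hf : ContDiff ℝ 2 f) :
    ContDiff ℝ 1 (fderiv ℝ f) ∧ Continuous (fderiv ℝ (fderiv ℝ f)) := by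
  have h1 : ContDiff ℝ 1 (fderiv ℝ f) := hf.fderiv_right (by norm_num)
  exact ⟨h1, h1.continuous_fderiv (by norm_num)⟩

/-- The derivative of the (unnormalised) circular mean of a `C¹` function in the radius. -/
theorem hasDerivAt_circle_integral {f : ℂ → ℝ} (hf : ContDiff ℝ 1 f) (z : ℂ) (ρ : ℝ) :
    HasDerivAt (fun r : ℝ => ∫ θ in -Real.pi..Real.pi, f (z + r * Complex.exp (θ * Complex.I)))
      (∫ θ in -Real.pi..Real.pi, fderiv ℝ f (z + ρ * Complex.exp (θ * Complex.I))
        (Complex.exp (θ * Complex.I))) ρ := by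
  have hg := hf.continuous_fderiv (by norm_num)
  have hf0 := hf.continuous
  refine hasDerivAt_intervalIntegral_of_continuous
    (u := fun r θ => f (z + r * Complex.exp (θ * Complex.I)))
    (u' := fun r θ => fderiv ℝ f (z + r * Complex.exp (θ * Complex.I))
        (Complex.exp (θ * Complex.I))) ?_ ?_ ?_ ρ
  · simp only [Function.uncurry_def]; fun_prop
  · simp only [Function.uncurry_def]; fun_prop
  · intro x t
    have h1 : HasDerivAt (fun y : ℝ => z + y * Complex.exp (t * Complex.I))
        (Complex.exp (t * Complex.I)) x := by
      simpa using ((Complex.ofRealCLM.hasDerivAt (x := x)).mul_const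
        (Complex.exp (t * Complex.I))).const_add z
    exact ((hf.differentiable (by norm_num)) _).hasFDerivAt.comp_hasDerivAt x h1

/-- The polar form of the Laplacian, integrated over a circle. -/
theorem hasDerivAt_mul_circle_integral_fderiv {f : ℂ → ℝ} (hf : ContDiff ℝ 2 f) (z : ℂ) (ρ : ℝ) :
    HasDerivAt (fun r : ℝ => r * ∫ θ in -Real.pi..Real.pi,
        fderiv ℝ f (z + r * Complex.exp (θ * Complex.I)) (Complex.exp (θ * Complex.I)))
      (ρ * ∫ θ in -Real.pi..Real.pi,
        Laplacian.laplacian f (z + ρ * Complex.exp (θ * Complex.I))) ρ := by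
  obtain ⟨h1, h2⟩ := continuous_fderiv_fderiv hf
  have h10 := h1.continuous
  have hd : ∀ w, HasFDerivAt (fderiv ℝ f) (fderiv ℝ (fderiv ℝ f) w) w := fun w =>
    (h1.differentiable (by norm_num) w).hasFDerivAt
  have hA := hasDerivAt_intervalIntegral_of_continuous (a := -Real.pi) (b := Real.pi)
    (u := fun r θ => fderiv ℝ f (z + r * Complex.exp (θ * Complex.I)) (Complex.exp (θ * Complex.I)))
    (u' := fun r θ => fderiv ℝ (fderiv ℝ f) (z + r * Complex.exp (θ * Complex.I))
      (Complex.exp (θ * Complex.I)) (Complex.exp (θ * Complex.I)))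
    (by simp only [Function.uncurry_def]; fun_prop)
    (by simp only [Function.uncurry_def]; fun_prop)
    (fun x t => by
      have h1 : HasDerivAt (fun y : ℝ => z + y * Complex.exp (t * Complex.I))
          (Complex.exp (t * Complex.I)) x := by
        simpa using ((Complex.ofRealCLM.hasDerivAt (x := x)).mul_const
          (Complex.exp (t * Complex.I))).const_add z
      simpa using ((hd _).comp_hasDerivAt x h1).clm_apply
        (hasDerivAt_const x (Complex.exp (t * Complex.I)))) ρ
  have hB := (hasDerivAt_id ρ).mul hA
  refine hB.congr_deriv ?_
  -- The tangential derivative is periodic in `θ`, so its `θ`-derivative integrates to zero. This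
  -- trades the integral of the radial derivative for `ρ` times that of the tangential second
  -- derivative.
  have hT : ∀ θ ∈ Set.uIcc (-Real.pi) Real.pi, HasDerivAt
      (fun t : ℝ => fderiv ℝ f (z + ρ * Complex.exp (t * Complex.I))
        (Complex.I * Complex.exp (t * Complex.I)))
      (ρ * fderiv ℝ (fderiv ℝ f) (z + ρ * Complex.exp (θ * Complex.I))
        (Complex.I * Complex.exp (θ * Complex.I)) (Complex.I * Complex.exp (θ * Complex.I)) -
        fderiv ℝ f (z + ρ * Complex.exp (θ * Complex.I)) (Complex.exp (θ * Complex.I))) θ := by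
    intro θ _
    have h3 : HasDerivAt (fun t : ℝ => z + ρ * Complex.exp (t * Complex.I))
        (ρ • (Complex.I * Complex.exp (θ * Complex.I))) θ := by
      simpa using ((hasDerivAt_exp_mul_I θ).const_mul (ρ : ℂ)).const_add z
    have h4 : HasDerivAt (fun t : ℝ => Complex.I * Complex.exp (t * Complex.I))
        (-Complex.exp (θ * Complex.I)) θ := by
      refine ((hasDerivAt_exp_mul_I θ).const_mul Complex.I).congr_deriv ?_
      rw [← mul_assoc, Complex.I_mul_I, neg_one_mul]
    refine (((hd _).comp_hasDerivAt θ h3).clm_apply h4).congr_deriv ?_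
    rw [map_smul, map_neg, ← sub_eq_add_neg, smul_apply, smul_eq_mul, Function.comp_apply]
  have hI := intervalIntegral.integral_eq_sub_of_hasDerivAt hT
    (Continuous.intervalIntegrable (by fun_prop) _ _)
  have hend : Complex.exp ((Real.pi : ℂ) * Complex.I) =
      Complex.exp (((-Real.pi : ℝ) : ℂ) * Complex.I) := by
    rw [Complex.exp_pi_mul_I]; push_cast
    rw [neg_mul, Complex.exp_neg, Complex.exp_pi_mul_I]; norm_num
  rw [hend, sub_self, intervalIntegral.integral_sub
    (Continuous.intervalIntegrable (by fun_prop) _ _)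
    (Continuous.intervalIntegrable (by fun_prop) _ _), intervalIntegral.integral_const_mul] at hI
  have hL : ∀ θ : ℝ, Laplacian.laplacian f (z + ρ * Complex.exp (θ * Complex.I)) = _ :=
    fun θ => laplacian_eq_sum_of_unit f _ θ
  simp_rw [hL]
  rw [intervalIntegral.integral_add
    (Continuous.intervalIntegrable (by fun_prop) _ _)
    (Continuous.intervalIntegrable (by fun_prop) _ _)]
  simp only [id]
  linarith

theorem continuous_laplacian {f : ℂ → ℝ} (hf : ContDiff ℝ 2 f) :
    Continuous (Laplacian.laplacian f) := by
  have h := (continuous_fderiv_fderiv hf).2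
  rw [InnerProductSpace.laplacian_eq_iteratedFDeriv_complexPlane]
  simp only [iteratedFDeriv_two_apply]
  fun_prop

/-- Integration over a disk in polar coordinates. -/
theorem integral_ball_eq_polar {φ : ℂ → ℝ} (hφ : Continuous φ) (z : ℂ) {ρ : ℝ} (hρ : 0 ≤ ρ) :
    ∫ w in ball z ρ, φ w = ∫ s in (0 : ℝ)..ρ, s * ∫ θ in -Real.pi..Real.pi,
      φ (z + s * Complex.exp (θ * Complex.I)) := by
  have e1 : ∫ w in ball z ρ, φ w = ∫ w, (ball (0 : ℂ) ρ).indicator (fun w => φ (z + w)) w := by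
    rw [← integral_indicator measurableSet_ball, ← integral_add_left_eq_self _ z]
    congr 1; ext w
    simp [Set.indicator]
  rw [e1, ← Complex.integral_comp_polarCoord_symm]
  have e2 : ∀ p ∈ polarCoord.target, p.1 • (ball (0 : ℂ) ρ).indicator (fun w => φ (z + w))
      (Complex.polarCoord.symm p) = (Set.Ioo 0 ρ ×ˢ Set.Ioo (-Real.pi) Real.pi).indicator
        (fun p : ℝ × ℝ => p.1 * φ (z + p.1 * Complex.exp (p.2 * Complex.I))) p := by
    rintro ⟨r, t⟩ ⟨hr, ht⟩
    simp only [Set.mem_Ioi] at hr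
    have : Complex.polarCoord.symm (r, t) = r * Complex.exp (t * Complex.I) := by
      rw [Complex.polarCoord_symm_apply, Complex.exp_mul_I]; simp
    rw [this]
    by_cases h : r < ρ
    · rw [Set.indicator_of_mem, Set.indicator_of_mem]
      · simp
      · exact ⟨⟨hr, h⟩, ht⟩
      · simpa [Complex.norm_exp_ofReal_mul_I, abs_of_pos hr] using h
    · rw [Set.indicator_of_notMem, Set.indicator_of_notMem]
      · simp
      · exact fun h' => h h'.1.2
      · simpa [Complex.norm_exp_ofReal_mul_I, abs_of_pos hr] using h
  rw [setIntegral_congr_fun polarCoord.open_target.measurableSet e2,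
    setIntegral_indicator (measurableSet_Ioo.prod measurableSet_Ioo)]
  have e3 : polarCoord.target ∩ (Set.Ioo 0 ρ ×ˢ Set.Ioo (-Real.pi) Real.pi) =
      Set.Ioo 0 ρ ×ˢ Set.Ioo (-Real.pi) Real.pi := by
    apply Set.inter_eq_right.2
    rintro ⟨r, t⟩ ⟨hr, ht⟩
    exact ⟨hr.1, ht⟩
  rw [e3, Measure.volume_eq_prod, setIntegral_prod]
  · rw [intervalIntegral.integral_of_le hρ, ← integral_Ioc_eq_integral_Ioo]
    refine setIntegral_congr_fun measurableSet_Ioc fun s _ => ?_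
    dsimp only
    rw [intervalIntegral.integral_of_le (by linarith [Real.pi_pos]),
      ← integral_const_mul, ← integral_Ioc_eq_integral_Ioo]
  · refine IntegrableOn.mono_set (t := Set.Icc 0 ρ ×ˢ Set.Icc (-Real.pi) Real.pi) ?_
      (Set.prod_mono Set.Ioo_subset_Icc_self Set.Ioo_subset_Icc_self)
    refine ContinuousOn.integrableOn_compact (isCompact_Icc.prod isCompact_Icc) ?_
    exact Continuous.continuousOn (by fun_prop)

/-! ### The perturbed mean value estimate -/

/-- A function whose Laplacian is dominated by its own size is controlled at the centre of a disk
by the growth of its `L¹` norms on the concentric disks. -/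
theorem abs_le_of_abs_laplacian_le {f : ℂ → ℝ} (hf : ContDiff ℝ 2 f) {z : ℂ} {R K α : ℝ}
    (hR : 0 < R) (hα : 0 < α) (hΔ : ∀ w ∈ closedBall z R, |Laplacian.laplacian f w| ≤ |f w|)
    (hK : ∀ s, 0 < s → s ≤ R → ∫ w in ball z s, |f w| ≤ K * s ^ α) :
    Real.pi * R ^ 2 * |f z| ≤ K * R ^ α * (1 + R ^ 2 / (2 * α)) := by
  have hpi : -Real.pi ≤ Real.pi := by linarith [Real.pi_pos]
  have hf0 := hf.continuous
  have hf1 := hf.continuous_fderiv (by norm_num)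
  have hΔc := continuous_laplacian hf
  have hK0 : 0 ≤ K := by
    have h1 : 0 ≤ ∫ w in ball z R, |f w| := integral_nonneg fun _ => abs_nonneg _
    exact nonneg_of_mul_nonneg_left (h1.trans (hK R hR le_rfl)) (Real.rpow_pos_of_pos hR α)
  have habs : Continuous fun w => |f w| := hf0.abs
  have hcA : Continuous fun s : ℝ => ∫ θ in -Real.pi..Real.pi,
      |f (z + s * Complex.exp (θ * Complex.I))| :=
    intervalIntegral.continuous_parametric_intervalIntegral_of_continuous' (by fun_prop) _ _
  have hcL : Continuous fun s : ℝ => ∫ θ in -Real.pi..Real.pi,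
      Laplacian.laplacian f (z + s * Complex.exp (θ * Complex.I)) :=
    intervalIntegral.continuous_parametric_intervalIntegral_of_continuous' (by fun_prop) _ _
  have hcG : Continuous fun s : ℝ => ∫ θ in -Real.pi..Real.pi,
      fderiv ℝ f (z + s * Complex.exp (θ * Complex.I)) (Complex.exp (θ * Complex.I)) :=
    intervalIntegral.continuous_parametric_intervalIntegral_of_continuous' (by fun_prop) _ _
  -- Divergence theorem: `ρ` times this flux is the integral of the Laplacian over the disk of
  -- radius `ρ`.
  have hflux : ∀ ρ, 0 < ρ → ρ ≤ R → |∫ θ in -Real.pi..Real.pi,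
      fderiv ℝ f (z + ρ * Complex.exp (θ * Complex.I)) (Complex.exp (θ * Complex.I))| ≤
        K * ρ ^ (α - 1) := by
    intro ρ hρ hρR
    have h1 := intervalIntegral.integral_eq_sub_of_hasDerivAt (a := 0) (b := ρ)
      (fun s _ => hasDerivAt_mul_circle_integral_fderiv hf z s)
      (Continuous.intervalIntegrable (by fun_prop) _ _)
    have h2 := intervalIntegral.norm_integral_le_of_norm_le (μ := volume) (a := 0) (b := ρ) hρ.le
      (f := fun s => s * ∫ θ in -Real.pi..Real.pi,
        Laplacian.laplacian f (z + s * Complex.exp (θ * Complex.I)))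
      (g := fun s => s * ∫ θ in -Real.pi..Real.pi, |f (z + s * Complex.exp (θ * Complex.I))|)
      (.of_forall fun s hs => by
        rw [norm_mul, Real.norm_of_nonneg hs.1.le]
        refine mul_le_mul_of_nonneg_left ?_ hs.1.le
        refine intervalIntegral.norm_integral_le_of_norm_le hpi (.of_forall fun θ _ => ?_)
          (Continuous.intervalIntegrable (by fun_prop) _ _)
        refine hΔ _ ?_
        simpa [Complex.norm_exp_ofReal_mul_I, abs_of_pos hs.1] using hs.2.trans hρR)
      (Continuous.intervalIntegrable (by fun_prop) _ _)
    rw [← integral_ball_eq_polar habs z hρ.le, h1, zero_mul, sub_zero, norm_mul,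
      Real.norm_of_nonneg hρ.le] at h2
    have h3 := h2.trans (hK ρ hρ hρR)
    rw [Real.rpow_sub_one hρ.ne', ← mul_div_assoc, le_div_iff₀ hρ, mul_comm]
    exact h3
  -- Integrate the flux bound from `0` to `ρ`; `α > 0` makes `s ^ (α - 1)` integrable at the centre.
  have hmean : ∀ ρ, 0 < ρ → ρ ≤ R → 2 * Real.pi * |f z| ≤ (∫ θ in -Real.pi..Real.pi,
      |f (z + ρ * Complex.exp (θ * Complex.I))|) + K * R ^ α / α := by
    intro ρ hρ hρR
    have h1 := intervalIntegral.integral_eq_sub_of_hasDerivAt (a := 0) (b := ρ)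
      (fun s _ => hasDerivAt_circle_integral (hf.of_le (by norm_num)) z s)
      (hcG.intervalIntegrable _ _)
    have hrp : IntervalIntegrable (fun s : ℝ => K * s ^ (α - 1)) volume 0 ρ :=
      (intervalIntegral.intervalIntegrable_rpow' (by linarith)).const_mul K
    have h2 := intervalIntegral.norm_integral_le_of_norm_le hρ.le
      (f := fun s : ℝ => ∫ θ in -Real.pi..Real.pi,
        fderiv ℝ f (z + s * Complex.exp (θ * Complex.I)) (Complex.exp (θ * Complex.I)))
      (.of_forall fun s hs => hflux s hs.1 (hs.2.trans hρR)) hrp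
    rw [h1, intervalIntegral.integral_const_mul, integral_rpow (Or.inl (by linarith))] at h2
    simp only [Complex.ofReal_zero, zero_mul, add_zero, intervalIntegral.integral_const,
      sub_add_cancel, Real.zero_rpow hα.ne', sub_zero, smul_eq_mul, Real.norm_eq_abs] at h2
    have h3 : |∫ θ in -Real.pi..Real.pi, f (z + ρ * Complex.exp (θ * Complex.I))| ≤
        ∫ θ in -Real.pi..Real.pi, |f (z + ρ * Complex.exp (θ * Complex.I))| :=
      intervalIntegral.abs_integral_le_integral_abs hpi
    have h4 : K * (ρ ^ α / α) ≤ K * R ^ α / α := by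
      rw [mul_div_assoc]; gcongr
    have h5 : |(Real.pi - -Real.pi) * f z| = 2 * Real.pi * |f z| := by
      rw [abs_mul, abs_of_pos (by linarith [Real.pi_pos])]; ring
    have h6 := abs_sub_abs_le_abs_sub ((Real.pi - -Real.pi) * f z)
      (∫ θ in -Real.pi..Real.pi, f (z + ρ * Complex.exp (θ * Complex.I)))
    rw [abs_sub_comm] at h6
    linarith
  -- Integrating against `s ds` turns the circular means into an area integral.
  have h7 := intervalIntegral.integral_mono_on (μ := volume) (a := 0) (b := R) hR.le
    (f := fun s : ℝ => s * (2 * Real.pi * |f z|))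
    (g := fun s : ℝ => s * (∫ θ in -Real.pi..Real.pi,
      |f (z + s * Complex.exp (θ * Complex.I))|) + s * (K * R ^ α / α))
    (Continuous.intervalIntegrable (by fun_prop) _ _)
    (Continuous.intervalIntegrable (by fun_prop) _ _)
    (fun s hs => by
      rcases hs.1.eq_or_lt with h | h
      · simp [← h]
      · simpa [mul_add] using mul_le_mul_of_nonneg_left (hmean s h hs.2) hs.1)
  rw [intervalIntegral.integral_add (Continuous.intervalIntegrable (by fun_prop) _ _)
    (Continuous.intervalIntegrable (by fun_prop) _ _), ← integral_ball_eq_polar habs z hR.le,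
    intervalIntegral.integral_mul_const, intervalIntegral.integral_mul_const, integral_id] at h7
  have h8 := hK R hR le_rfl
  have h9 : (R ^ 2 - 0 ^ 2) / 2 * (K * R ^ α / α) = K * R ^ α * (R ^ 2 / (2 * α)) := by
    field_simp; ring
  rw [h9] at h7
  linarith

/-! ### Hölder, pointwise bounds and cut-off -/

/-- Hölder against the constant `1`; the powers of `π` and `s` come from the disk's area `π s²`. -/
theorem integral_abs_ball_le_eLpNorm {f : ℂ → ℝ} (hf : Continuous f) {q : ℝ} (hq : 1 ≤ q)
    (z : ℂ) {s : ℝ} (hs : 0 ≤ s)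
    (hfin : eLpNorm f (ENNReal.ofReal q) (volume.restrict (ball z s)) ≠ ⊤) :
    ∫ w in ball z s, |f w| ≤
      (eLpNorm f (ENNReal.ofReal q) (volume.restrict (ball z s))).toReal *
        Real.pi ^ (1 - 1 / q) * s ^ (2 * (1 - 1 / q)) := by
  have hq1 : 0 ≤ 1 - 1 / q := by
    rw [sub_nonneg, div_le_one (by linarith)]; exact hq
  have h1 := eLpNorm_le_eLpNorm_mul_rpow_measure_univ (μ := volume.restrict (ball z s))
    (p := 1) (q := ENNReal.ofReal q) (f := f) (by simpa using hq) hf.aestronglyMeasurable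
  have hvol : (volume (ball z s)).toReal = Real.pi * s ^ 2 := by
    rw [Complex.volume_ball]; simp [hs, mul_comm]
  have h2 : ∫ w in ball z s, |f w| = (eLpNorm f 1 (volume.restrict (ball z s))).toReal := by
    rw [eLpNorm_one_eq_lintegral_enorm, ← integral_norm_eq_lintegral_enorm hf.aestronglyMeasurable]
    rfl
  rw [h2]
  simp only [Measure.restrict_apply_univ, ENNReal.toReal_one, div_one,
    ENNReal.toReal_ofReal (by linarith : 0 ≤ q)] at h1
  refine (ENNReal.toReal_mono (ENNReal.mul_ne_top hfin
    (ENNReal.rpow_ne_top_of_nonneg hq1 measure_ball_lt_top.ne)) h1).trans ?_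
  rw [ENNReal.toReal_mul, ← ENNReal.toReal_rpow, hvol, Real.mul_rpow Real.pi_pos.le (by positivity),
    mul_assoc, Real.rpow_mul hs]
  simp

/-- A violation at one point would persist on a nonempty open set, which has positive measure. -/
theorem ContinuousOn.norm_le_of_eLpNorm_top_lt {p : ℂ → ℝ} {U : Set ℂ} (hU : IsOpen U)
    (hp : ContinuousOn p U) {ε : ℝ} (h : eLpNorm p ∞ (volume.restrict U) ≤ ENNReal.ofReal ε)
    (hε : 0 ≤ ε) {w : ℂ} (hw : w ∈ U) : |p w| ≤ ε := by
  by_contra! hlt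
  have hV : IsOpen (U ∩ (fun w => |p w|) ⁻¹' Set.Ioi ε) := hp.abs.isOpen_inter_preimage hU isOpen_Ioi
  have hpos := hV.measure_pos volume ⟨w, hw, hlt⟩
  rw [eLpNorm_exponent_top] at h
  have hae : ∀ᵐ w ∂volume.restrict U, |p w| ≤ ε := by
    filter_upwards [ae_le_eLpNormEssSup (f := p) (μ := volume.restrict U)] with w hw
    have := hw.trans h
    rwa [Real.enorm_eq_ofReal_abs, ENNReal.ofReal_le_ofReal_iff hε] at this
  rw [ae_restrict_iff' hU.measurableSet, ae_iff] at hae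
  refine hpos.ne' (measure_mono_null (fun v hv => ?_) hae)
  simpa using hv

/-- A `C²` function on a disk agrees with a globally `C²` one on any smaller disk. -/
theorem ContDiffOn.exists_contDiff_eqOn_ball {F : ℂ → ℝ} {a b : ℝ} (ha : 0 < a) (hab : a < b)
    (hF : ContDiffOn ℝ 2 F (ball 0 b)) :
    ∃ f : ℂ → ℝ, ContDiff ℝ 2 f ∧ Set.EqOn f F (ball 0 a) := by
  -- The outer radius lies strictly below `b`, so the product vanishes near every point where `F`
  -- may fail to be smooth.
  let χ : ContDiffBump (0 : ℂ) := ⟨a, (a + b) / 2, ha, by linarith⟩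
  refine ⟨fun w => χ w * F w, contDiff_iff_contDiffAt.2 fun w => ?_, fun w hw => ?_⟩
  · by_cases hw : w ∈ ball (0 : ℂ) b
    · exact χ.contDiffAt.mul (hF.contDiffAt (isOpen_ball.mem_nhds hw))
    · have : (fun w => χ w * F w) =ᶠ[nhds w] fun _ => 0 := by
        have hw' : w ∈ (closedBall (0 : ℂ) ((a + b) / 2))ᶜ := by
          simp only [mem_ball, mem_closedBall, Set.mem_compl_iff] at hw ⊢
          linarith
        filter_upwards [isClosed_closedBall.isOpen_compl.mem_nhds hw'] with v hv
        rw [χ.zero_of_le_dist, zero_mul]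
        simp only [mem_closedBall, Set.mem_compl_iff, not_le] at hv
        exact hv.le
      exact contDiffAt_const.congr_of_eventuallyEq this
  · simp only
    rw [χ.one_of_mem_closedBall (ball_subset_closedBall hw), one_mul]

/-! ### The main theorem -/

theorem mainTheorem4 :
    ∃ ε₀ : ℝ, 0 < ε₀ ∧
      ∀ q r₁ r₂ : ℝ, 1 < q → 0 < r₁ → r₁ < r₂ →
        ∃ c₄ : ℝ, 0 < c₄ ∧
          ∀ r₀ : ℝ, r₂ ≤ r₀ →
            ∀ p F : ℂ → ℝ,
              ContDiffOn ℝ ∞ p (ball (0 : ℂ) r₀) →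
              diskLpNorm ∞ r₀ p < ENNReal.ofReal ε₀ →
              IsSchrodingerSolutionOn F p (ball (0 : ℂ) r₀) →
              diskLpNorm ∞ r₁ F ≤ ENNReal.ofReal c₄ * diskLpNorm (ENNReal.ofReal q) r₂ F := by
  -- The value `1` only normalises the bound to `|ΔF| ≤ |F|`.
  refine ⟨1, one_pos, fun q r₁ r₂ hq hr₁ hr => ?_⟩
  have hq1 : 0 < 1 - 1 / q := by
    rw [sub_pos, div_lt_one (by linarith)]; exact hq
  set α : ℝ := 2 * (1 - 1 / q) with hα
  have hα0 : 0 < α := by positivity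
  -- Thirds leave a gap: disks of radius `R` about points of `ball 0 r₁` lie in `ball 0 (r₁ + 2 *
  -- R)`, and `r₁ + 2 * R < r₂` leaves room for the cut-off even when `r₂ = r₀`.
  set R : ℝ := (r₂ - r₁) / 3 with hRdef
  have hR : 0 < R := by rw [hRdef]; linarith
  set c : ℝ := Real.pi ^ (1 - 1 / q) * R ^ α * (1 + R ^ 2 / (2 * α)) / (Real.pi * R ^ 2) with hc
  have hπ := Real.pi_pos
  have hc0 : 0 < c := by positivity
  refine ⟨c, hc0, fun r₀ hr₀ p F hp hpε hF => ?_⟩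
  by_cases htop : diskLpNorm (ENNReal.ofReal q) r₂ F = ⊤
  · rw [htop, ENNReal.mul_top (by simpa using hc0)]; exact le_top
  obtain ⟨f, hf, hfF⟩ := (hF.1.mono (ball_subset_ball hr₀)).exists_contDiff_eqOn_ball
    (a := r₁ + 2 * R) (by linarith) (by rw [hRdef]; linarith)
  have hp1 : ∀ w ∈ ball (0 : ℂ) r₀, |p w| ≤ 1 := fun w hw =>
    hp.continuousOn.norm_le_of_eLpNorm_top_lt isOpen_ball hpε.le zero_le_one hw
  have ha : r₁ + 2 * R ≤ r₂ := by rw [hRdef]; linarith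
  set N := diskLpNorm (ENNReal.ofReal q) r₂ F with hN
  have key : ∀ z ∈ ball (0 : ℂ) r₁, ‖F z‖ ≤ c * N.toReal := by
    intro z hz
    have hsub : closedBall z R ⊆ ball (0 : ℂ) (r₁ + 2 * R) := fun w hw => by
      simp only [mem_ball, mem_closedBall] at hz hw ⊢
      linarith [dist_triangle w z 0]
    have hnorm : ∀ s ≤ R, eLpNorm f (ENNReal.ofReal q) (volume.restrict (ball z s)) ≤ N := by
      intro s hs
      have hs' : ball z s ⊆ ball (0 : ℂ) (r₁ + 2 * R) :=
        (ball_subset_closedBall.trans (closedBall_subset_closedBall hs)).trans hsub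
      rw [eLpNorm_congr_ae (ae_restrict_of_forall_mem measurableSet_ball
        fun w hw => hfF (hs' hw))]
      exact eLpNorm_mono_measure F
        (Measure.restrict_mono (hs'.trans (ball_subset_ball ha)) le_rfl)
    have hmain := abs_le_of_abs_laplacian_le hf (z := z) (K := N.toReal * Real.pi ^ (1 - 1 / q))
      hR hα0 (fun w hw => by
        have hw' := hsub hw
        have heq : f =ᶠ[nhds w] F := hfF.eventuallyEq_of_mem (isOpen_ball.mem_nhds hw')
        rw [(InnerProductSpace.laplacian_congr_nhds heq).self_of_nhds, hfF hw',
          eq_neg_of_add_eq_zero_left (hF.2 w (ball_subset_ball (ha.trans hr₀) hw')), abs_neg,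
          abs_mul]
        exact mul_le_of_le_one_left (abs_nonneg _)
          (hp1 w (ball_subset_ball (ha.trans hr₀) hw')))
      (fun s hs hsR => by
        refine (integral_abs_ball_le_eLpNorm hf.continuous hq.le z hs.le
          (ne_top_of_le_ne_top htop (hnorm s hsR))).trans ?_
        gcongr
        exact hnorm s hsR)
    rw [← hfF (hsub (mem_closedBall_self hR.le)), Real.norm_eq_abs, hc, div_mul_eq_mul_div,
      le_div_iff₀ (by positivity)]
    linarith
  have hfin : eLpNorm F ∞ (volume.restrict (ball 0 r₁)) ≤ ENNReal.ofReal (c * N.toReal) := by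
    rw [eLpNorm_exponent_top]
    exact eLpNormEssSup_le_of_ae_bound (ae_restrict_of_forall_mem measurableSet_ball key)
  rwa [ENNReal.ofReal_mul hc0.le, ENNReal.ofReal_toReal htop] at hfin
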